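/- **Setting.** Let $E$ be a finite-dimensional real inner product space (for example $\mathbb R^{d_o}$) with induced norm $\|\cdot\|_{\mathcal U}$, and let $F$ be a finite-dimensional real vector space (for example $\mathbb R^{d_r}$) with a norm $\|\cdot\|_{\mathcal X}$. Let $\mathcal U\subset E$ be compact and convex, let $\mathcal X\subset F$ be open and bounded, and let $\mu$ be a Borel probability measure on $F$ with $\operatorname{supp}\mu\subset\mathcal X$. Let $j\in C^1(\mathcal U\times\mathcal X;\mathbb R)$, that is, $j$ is differentiable relative to $\mathcal U\times\mathcal X$ at each of its points, with a derivative that is continuous on $\mathcal U\times\mathcal X$; write $\nabla_1 j$ for the resulting partial gradient in the first variable. Put $$J(u)=\int_{\mathcal X} j(u,x)\,\mu(\mathrm dx)\qquad(u\in\mathcal U),$$ and suppose that $J$ is $L$-smooth on $\mathcal U$ for some $L>0$, that is, $\|\nabla J(u_1)-\nabla J(u_2)\|_{\mathcal U}\le L\|u_1-u_2\|_{\mathcal U}$ for all $u_1,u_2\in\mathcal U$. (If $\mathcal U$ has empty interior, derivatives relative to $\mathcal U$ need not be unique; the result then holds for every choice of $\nabla_1 j$ and $\nabla J$ with these properties.)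 Let $\mathcal P_{\mathcal U}$ be the orthogonal projection onto $\mathcal U$ and let $$\mathcal S(J)=\{u\in\mathcal U:\ \mathcal P_{\mathcal U}(u-t\nabla J(u))=u\text{ for some }t>0\}$$ be the set of stationary points of $J$. **Algorithm.** Let $x_1,x_2,\dots$ and $y_1,y_2,\dots$ be independent random variables with law $\mu$, all of them jointly independent; the auxiliary samples $y_i$ are used only by method (iii) below. Given a starting point $u_1\in\mathcal U$ and a step size $\tau$, the CSG method with constant step size $\tau$ produces the iterates $$u_{n+1}=\mathcal P_{\mathcal U}\big(u_n-\tau\hat G_n\big),\qquad \hat G_n=\sum_{k=1}^n\alpha_k^{(n)}\,\nabla_1 j(u_k,x_k),\qquad n\ge 1.$$ The weights $\alpha^{(n)}_k$ are computed as follows. For $k\le n$ let $$M_k=\{x:\ \|u_n-u_k\|_{\mathcal U}+\|x-x_k\|_{\mathcal X}\le\|u_n-u_i\|_{\mathcal U}+\|x-x_i\|_{\mathcal X}\ \ \forall i\le n\},\qquad M_k'=\{x:\ \|x-x_k\|_{\mathcal X}\le\|x-x_i\|_{\mathcal X}\ \ \forall i\le n\},$$ where a point lying in several cells is assigned to exactly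 one of them, by a fixed measurable rule that depends only on $n$, the point in question and, for $M_k$, on $(u_i,x_i)_{i\le n}$, respectively, for $M_k'$, on $(x_i)_{i\le n}$. The weights are given, for all $n$, by one of the following methods: - (i) exact: $\alpha_k^{(n)}=\mu(M_k)$; - (ii) exact hybrid: $\alpha_k^{(n)}=\sum_{i\le n,\ x_i\in M_k}\mu(M_i')$; - (iii) inexact hybrid: as (ii), with $\mu(M_i')$ replaced by the fraction of the points $x_1,\dots,x_n,y_1,\dots,y_{m(n)}$ (counted with multiplicity) that lie in $M_i'$, where $m:\mathbb N\to\mathbb N_0$ is an arbitrary given function; - (iv) empirical: $\alpha_k^{(n)}=\frac1n\,\#\{i\le n:\ x_i\in M_k\}$. **Theorem.** Suppose that $0<\tau<\tfrac2L$ and that the set $$\mathcal N=\{J(u):\ u\in\mathcal S(J)\}\subset\mathbb R$$ has Lebesgue measure zero. Then, almost surely, every accumulation point of the sequence $(u_n)_{n\in\mathbb N}$ generated by the CSG method with constant step size $\tau$ is a stationary point of $J$, and the sequence of function values $(J(u_n))_{n\in\mathbb N}$ converges in $\mathbb R$. -/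

import Mathlib

open MeasureTheory ProbabilityTheory Filter Topology

noncomputable section

namespace CSG

/-- `p` is the orthogonal projection of `v` onto `U`, i.e. `p` minimises `w ↦ ‖v - w‖` over `U`. -/
def IsProj {E : Type*} [NormedAddCommGroup E] (U : Set E) (v p : E) : Prop :=
  p ∈ U ∧ ∀ w ∈ U, ‖v - p‖ ≤ ‖v - w‖

/-- `j` is of class `C¹` on `U × X` with derivative `j'`: at every point of `U × X` the function
`(u, x) ↦ j u x` is differentiable relative to `U × X` with derivative `j' u x`, and `j'` is
continuous on `U × X`. -/
structure IsC1On {E F : Type*} [NormedAddCommGroup E] [NormedSpace ℝ E]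
    [NormedAddCommGroup F] [NormedSpace ℝ F]
    (j : E → F → ℝ) (j' : E → F → (E × F →L[ℝ] ℝ)) (U : Set E) (X : Set F) : Prop where
  hasFDerivWithinAt : ∀ u ∈ U, ∀ x ∈ X,
    HasFDerivWithinAt (Function.uncurry j) (j' u x) (U ×ˢ X) (u, x)
  continuousOn : ContinuousOn (Function.uncurry j') (U ×ˢ X)

/-- The partial gradient `∇₁ j (u, x)`: the vector representing the restriction of the derivative
`j' u x` to the first factor. -/
def grad₁ {E F : Type*} [NormedAddCommGroup E] [InnerProductSpace ℝ E] [CompleteSpace E]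
    [NormedAddCommGroup F] [NormedSpace ℝ F]
    (j' : E → F → (E × F →L[ℝ] ℝ)) (u : E) (x : F) : E :=
  (InnerProductSpace.toDual ℝ E).symm ((j' u x).comp (ContinuousLinearMap.inl ℝ E F))

/-- The objective function `J(u) = ∫ j(u, x) μ(dx)`. -/
def objective {E F : Type*} [MeasurableSpace F] (μ : Measure F) (j : E → F → ℝ) (u : E) : ℝ :=
  ∫ x, j u x ∂μ

/-- `J` is `L`-smooth on `U`, with gradient `G` on `U`. -/
structure IsLSmoothOn {E : Type*} [NormedAddCommGroup E] [InnerProductSpace ℝ E] [CompleteSpace E]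
    (J : E → ℝ) (G : E → E) (L : ℝ) (U : Set E) : Prop where
  hasGradientWithinAt : ∀ u ∈ U, HasGradientWithinAt J (G u) U u
  lipschitz : ∀ u₁ ∈ U, ∀ u₂ ∈ U, ‖G u₁ - G u₂‖ ≤ L * ‖u₁ - u₂‖

/-- The set `S(J)` of stationary points on `U` of a function with gradient `G`. -/
def stationarySet {E : Type*} [NormedAddCommGroup E] [NormedSpace ℝ E]
    (U : Set E) (G : E → E) : Set E :=
  {u | u ∈ U ∧ ∃ t : ℝ, 0 < t ∧ IsProj U (u - t • G u) u}

/-- A nearest neighbour assignment for the distance `d`: to finitely many points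
`h 0, …, h n` and a query point `a`, it assigns the index of a point closest to `a`. Such an
assignment is unique up to the way in which ties are broken, which may be any measurable one. -/
structure NearestRule (α : Type*) [MeasurableSpace α] (d : α → α → ℝ) where
  idx : ∀ n : ℕ, (Fin (n + 1) → α) → α → Fin (n + 1)
  measurable_idx : ∀ n, Measurable fun p : (Fin (n + 1) → α) × α => idx n p.1 p.2
  nearest : ∀ (n : ℕ) (h : Fin (n + 1) → α) (a : α) (k : Fin (n + 1)), d a (h (idx n h a)) ≤ d a (h k)

/-- The distance `‖u - u'‖ + ‖x - x'‖` on `U × X`. -/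
def sumDist {E F : Type*} [NormedAddCommGroup E] [NormedAddCommGroup F] (p q : E × F) : ℝ :=
  ‖p.1 - q.1‖ + ‖p.2 - q.2‖

/-- The distance `‖x - x'‖` on `X`. -/
def normDist {F : Type*} [NormedAddCommGroup F] (x x' : F) : ℝ := ‖x - x'‖

/-- The methods for computing the integration weights. In the inexact hybrid method,
`m n` is the number of auxiliary samples available in iteration `n`. -/
inductive WeightMethod : Type
  | exact
  | exactHybrid
  | inexactHybrid (m : ℕ → ℕ)
  | empirical

section Algorithm

variable {E F : Type*} [NormedAddCommGroup E] [NormedAddCommGroup F]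
  [MeasurableSpace E] [MeasurableSpace F]

/-- The index `k ≤ n` for which `s` lies in the cell
`M_k = {s : ‖u n - u k‖ + ‖s - x k‖ ≤ ‖u n - u i‖ + ‖s - x i‖ for all i ≤ n}`. -/
def cell (R : NearestRule (E × F) sumDist) (u : ℕ → E) (x : ℕ → F) (n : ℕ) (s : F) :
    Fin (n + 1) :=
  R.idx n (fun i => (u i, x i)) (u n, s)

/-- The index `k ≤ n` for which `s` lies in the cell
`M'_k = {s : ‖s - x k‖ ≤ ‖s - x i‖ for all i ≤ n}`. -/
def sampleCell (Q : NearestRule F normDist) (x : ℕ → F) (n : ℕ) (s : F) : Fin (n + 1) :=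
  Q.idx n (fun i => x i) s

open Classical in
/-- The weight `α_k` in iteration `n`, given iterates `u 0, …, u n`, samples `x 0, …, x n` and
auxiliary samples `y`.
* exact: `α_k = μ(M_k)`;
* exact hybrid: `α_k` is the sum of `μ(M'_i)` over all `i ≤ n` with `x i ∈ M_k`;
* inexact hybrid: as before, with `μ(M'_i)` replaced by the fraction of those of the points
  `x 0, …, x n, y 0, …, y (m n - 1)` that lie in `M'_i`;
* empirical: `α_k` is the fraction of those of the points `x 0, …, x n` that lie in `M_k`. -/
def weight (μ : Measure F) (R : NearestRule (E × F) sumDist) (Q : NearestRule F normDist)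
    (w : WeightMethod) (u : ℕ → E) (x y : ℕ → F) (n : ℕ) (k : Fin (n + 1)) : ℝ :=
  match w with
  | .exact => μ.real {s | cell R u x n s = k}
  | .exactHybrid =>
      ∑ i : Fin (n + 1), if cell R u x n (x i) = k then μ.real {s | sampleCell Q x n s = i} else 0
  | .inexactHybrid m =>
      ∑ i : Fin (n + 1), if cell R u x n (x i) = k then
        ((((Finset.range (n + 1)).filter fun l => sampleCell Q x n (x l) = i).card : ℝ)
          + (((Finset.range (m n)).filter fun l => sampleCell Q x n (y l) = i).card : ℝ))
          / ((n : ℝ) + 1 + (m n : ℝ)) else 0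
  | .empirical =>
      (((Finset.range (n + 1)).filter fun l => cell R u x n (x l) = k).card : ℝ) / ((n : ℝ) + 1)

/-- The search direction `Ĝ_n = ∑_{k ≤ n} α_k ∇₁ j (u k, x k)`; here `g = ∇₁ j`. -/
def direction [NormedSpace ℝ E] (μ : Measure F) (g : E → F → E)
    (R : NearestRule (E × F) sumDist) (Q : NearestRule F normDist)
    (w : WeightMethod) (u : ℕ → E) (x y : ℕ → F) (n : ℕ) : E :=
  ∑ k : Fin (n + 1), weight μ R Q w u x y n k • g (u k) (x k)

/-- `u` is the sequence of iterates of the CSG method on `U` with starting point `u₀`, constant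
step size `τ`, samples `x` and auxiliary samples `y`. (Indices start at `0`.) -/
structure IsCSG [NormedSpace ℝ E] (U : Set E) (μ : Measure F) (g : E → F → E)
    (R : NearestRule (E × F) sumDist) (Q : NearestRule F normDist)
    (w : WeightMethod) (τ : ℝ) (u₀ : E) (x y : ℕ → F) (u : ℕ → E) : Prop where
  start : u 0 = u₀
  step : ∀ n, IsProj U (u n - τ • direction μ g R Q w u x y n) (u (n + 1))

end Algorithm

end CSG

end

/-!
Let `K` be the support of `μ`, a compact subset of `X`, and let `g` be the partial gradient of `j`
in the first variable, which is uniformly continuous on `U ×ˢ K`. The proof has a probabilistic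
and a deterministic part.

*The search direction is consistent.* Almost surely, `direction n - ∫ g (u n) dμ` tends to zero.
The iterate `u n` depends on the past only, whereas the sample `x n` is independent of it. Hence,
if the iterates visit a ball of `U` infinitely often, the conditional Borel–Cantelli lemma shows
that at some of these visits the sample falls into any prescribed ball around a point of `K`
(`ae_frequently_and`). By compactness, every `(u n, s)` with `s ∈ K` eventually has a point
`(u k, x k)` of the history nearby, uniformly in `s` (`ae_eventually_isCovered`). In each method
the direction is an average of `g` at nearest neighbours, so it is close to the average of
`g (u n)` over `μ` or over an empirical measure; the latter is handled by a law of large numbers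
that is uniform on `U` (`ae_uniformLLN`), obtained from the strong law in `C(U, E)`.
The four methods are compared in `tendsto_direction_sub`.

*Vanishing errors suffice.* Since `⟪∫ g u dμ, v - w⟫ = ⟪∇J u, v - w⟫` for `v, w ∈ U`
(`inner_integral_grad₁_eq`), the iterates are those of a projected gradient method with errors
`e n → 0`. The descent lemma gives `J (u (n + 1)) ≤ J (u n) - c ‖d‖ ^ 2 + ‖e n‖ ‖d‖` with
`d = u (n + 1) - u n` and `c = 1 / τ - L / 2 > 0`. The errors need not be summable, so `J` may
increase; but an increasing step has `‖d‖ ≤ ‖e n‖ / c`, and accumulation points along such steps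
are stationary. Therefore near any value `v ∉ J '' S(J)` the values eventually decrease
(`IsPerturbedStep.eventually_le`), and since upward jumps tend to zero, `v` can no longer be
crossed upwards. Such `v` are dense because `J '' S(J)` is a null set, so `J (u n)` converges;
then the steps tend to zero and all accumulation points are stationary
(`IsPerturbedStep.converges`).
-/

namespace CSG

open scoped RealInnerProductSpace

/-! ### Projections onto convex sets -/

section Projection

variable {E : Type*} [NormedAddCommGroup E] [InnerProductSpace ℝ E] {U : Set E}

theorem isProj_iff_inner_le_zero (hU : Convex ℝ U) {v p : E} :
    IsProj U v p ↔ p ∈ U ∧ ∀ w ∈ U, ⟪v - p, w - p⟫ ≤ 0 := by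
  refine and_congr_right fun hp => ?_
  rw [← norm_eq_iInf_iff_real_inner_le_zero hU hp]
  have : Nonempty U := ⟨⟨p, hp⟩⟩
  have hbdd : BddBelow (Set.range fun w : U => ‖v - w‖) :=
    ⟨0, by rintro _ ⟨w, rfl⟩; exact norm_nonneg _⟩
  refine ⟨fun h => le_antisymm (le_ciInf fun w => h w w.2) (ciInf_le hbdd ⟨p, hp⟩), fun h w hw => ?_⟩
  rw [h]
  exact ciInf_le hbdd ⟨w, hw⟩

theorem IsProj.norm_sub_le (hU : Convex ℝ U) {v v' p p' : E} (h : IsProj U v p)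
    (h' : IsProj U v' p') : ‖p - p'‖ ≤ ‖v - v'‖ := by
  rw [isProj_iff_inner_le_zero hU] at h h'
  have h1 := h.2 p' h'.1
  have h2 := h'.2 p h.1
  have h3 : ⟪p - p', p - p'⟫ ≤ ⟪v - v', p - p'⟫ := by
    have e : ⟪v - v', p - p'⟫ - ⟪p - p', p - p'⟫
        = -⟪v - p, p' - p⟫ - ⟪v' - p', p - p'⟫ := by
      simp only [inner_sub_left, inner_sub_right]
      ring
    linarith
  have h4 := real_inner_le_norm (v - v') (p - p')
  rw [real_inner_self_eq_norm_sq] at h3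
  by_contra! hlt
  nlinarith [norm_nonneg (v - v')]

/-- The projection onto a nonempty compact convex set exists and is continuous. -/
theorem exists_continuous_isProj (hUc : IsCompact U) (hU : Convex ℝ U) (hne : U.Nonempty) :
    ∃ π : E → E, Continuous π ∧ ∀ v, IsProj U v (π v) := by
  have : ∀ v, ∃ p, IsProj U v p := fun v => by
    obtain ⟨p, hp, h⟩ := hUc.exists_isMinOn hne
      (f := fun w => ‖v - w‖) (by fun_prop)
    exact ⟨p, hp, h⟩
  choose π hπ using this
  refine ⟨π, ?_, hπ⟩
  refine (LipschitzWith.of_dist_le_mul (K := 1) fun v v' => ?_).continuous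
  simpa [dist_eq_norm] using (hπ v).norm_sub_le hU (hπ v')

theorem IsProj.unique (hU : Convex ℝ U) {v p p' : E} (h : IsProj U v p) (h' : IsProj U v p') :
    p = p' := by
  simpa [sub_eq_zero] using h.norm_sub_le hU h'

theorem mapsTo_segment (hU : Convex ℝ U) {u v : E} (hu : u ∈ U) (hv : v ∈ U) :
    Set.MapsTo (fun t : ℝ => u + t • (v - u)) (Set.Icc 0 1) U :=
  fun _ ht => hU.add_smul_sub_mem hu hv ht

end Projection

/-! ### Smooth functions along segments -/

section Smooth

variable {E : Type*} [NormedAddCommGroup E] [InnerProductSpace ℝ E] [CompleteSpace E]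
  {U : Set E} {J : E → ℝ} {G : E → E} {L : ℝ}

theorem hasDerivWithinAt_segment (hU : Convex ℝ U) (hJ : ∀ u ∈ U, HasGradientWithinAt J (G u) U u)
    {u v : E} (hu : u ∈ U) (hv : v ∈ U) {t : ℝ} (ht : t ∈ Set.Icc (0 : ℝ) 1) :
    HasDerivWithinAt (fun t : ℝ => J (u + t • (v - u))) ⟪G (u + t • (v - u)), v - u⟫
      (Set.Icc 0 1) t := by
  have h1 := (hJ _ (mapsTo_segment hU hu hv ht)).hasFDerivWithinAt
  have h2 : HasDerivWithinAt (fun t : ℝ => u + t • (v - u)) (v - u) (Set.Icc 0 1) t := by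
    simpa using (((hasDerivAt_id t).smul_const (v - u)).const_add u).hasDerivWithinAt
  exact (h1.comp_hasDerivWithinAt t h2 (mapsTo_segment hU hu hv)).congr_deriv (by simp)

/-- The descent lemma for `L`-smooth functions on a convex set. -/
theorem IsLSmoothOn.le_add_inner (hU : Convex ℝ U) (hJ : IsLSmoothOn J G L U)
    {u v : E} (hu : u ∈ U) (hv : v ∈ U) :
    J v ≤ J u + ⟪G u, v - u⟫ + L / 2 * ‖v - u‖ ^ 2 := by
  set d := v - u with hd
  have hder : ∀ t ∈ Set.Icc (0 : ℝ) 1, HasDerivWithinAt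
      (fun t : ℝ => J (u + t • d) - (t * ⟪G u, d⟫ + t ^ 2 * (L / 2 * ‖d‖ ^ 2)))
      (⟪G (u + t • d), d⟫ - (⟪G u, d⟫ + 2 * t * (L / 2 * ‖d‖ ^ 2))) (Set.Icc 0 1) t := by
    intro t ht
    have h3 : HasDerivAt (fun t : ℝ => t * ⟪G u, d⟫ + t ^ 2 * (L / 2 * ‖d‖ ^ 2))
        (⟪G u, d⟫ + 2 * t * (L / 2 * ‖d‖ ^ 2)) t := by
      exact (((hasDerivAt_id' t).mul_const _).add
        ((hasDerivAt_pow 2 t).mul_const (L / 2 * ‖d‖ ^ 2))).congr_deriv (by simp)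
    exact (hasDerivWithinAt_segment hU hJ.hasGradientWithinAt hu hv ht).sub h3.hasDerivWithinAt
  have hanti := antitoneOn_of_hasDerivWithinAt_nonpos (convex_Icc (0 : ℝ) 1)
    (fun t ht => (hder t ht).continuousWithinAt)
    (fun t ht => (hder t (interior_subset ht)).mono interior_subset) (fun t ht => ?_)
  · have := hanti (Set.left_mem_Icc.2 zero_le_one) (Set.right_mem_Icc.2 zero_le_one) zero_le_one
    simp [hd] at this
    linarith
  · have ht' := interior_subset ht
    have h4 := hJ.lipschitz _ (mapsTo_segment hU hu hv ht') u hu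
    have h5 := real_inner_le_norm (G (u + t • d) - G u) d
    rw [inner_sub_left] at h5
    have h6 : ‖u + t • d - u‖ = t * ‖d‖ := by
      rw [add_sub_cancel_left, norm_smul, Real.norm_of_nonneg ht'.1]
    simp only [← hd] at h4
    rw [h6] at h4
    have h7 := mul_le_mul_of_nonneg_right h4 (norm_nonneg d)
    nlinarith

theorem IsLSmoothOn.continuousOn_gradient (hJ : IsLSmoothOn J G L U) : ContinuousOn G U := by
  refine (LipschitzOnWith.of_dist_le_mul (K := L.toNNReal) fun u hu v hv => ?_).continuousOn
  rw [dist_eq_norm, dist_eq_norm]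
  exact (hJ.lipschitz u hu v hv).trans
    (mul_le_mul_of_nonneg_right (Real.le_coe_toNNReal L) (norm_nonneg _))

end Smooth

/-! ### Projected gradient steps with a vanishing error -/

section Optimisation

variable {E : Type*} [NormedAddCommGroup E] [InnerProductSpace ℝ E]
  {U : Set E} {J : E → ℝ} {G : E → E} {L τ : ℝ} {u e : ℕ → E}

/-- One step of the projected gradient method with error `e n`, written as a variational
inequality. Only the action of the error on directions between points of `U` matters. -/
def IsPerturbedStep (U : Set E) (G : E → E) (τ : ℝ) (u e : ℕ → E) : Prop :=
  ∀ n, ∀ w ∈ U, ⟪u n - τ • (G (u n) + e n) - u (n + 1), w - u (n + 1)⟫ ≤ 0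

/-- Along a filter on which the steps become small, limits of the iterates are stationary. -/
theorem IsPerturbedStep.mem_stationarySet (hU : Convex ℝ U)
    (hG : ContinuousOn G U) (hτ : 0 < τ) (huU : ∀ n, u n ∈ U) (hstep : IsPerturbedStep U G τ u e)
    (he : Tendsto e atTop (𝓝 0)) {l : Filter ℕ} [l.NeBot] (hl : l ≤ atTop)
    (hd : Tendsto (fun n => u (n + 1) - u n) l (𝓝 0)) {p : E} (hp : p ∈ U)
    (hup : Tendsto u l (𝓝 p)) : p ∈ stationarySet U G := by
  refine ⟨hp, τ, hτ, (isProj_iff_inner_le_zero hU).2 ⟨hp, fun w hw => ?_⟩⟩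
  have hGp : Tendsto (fun n => G (u n)) l (𝓝 (G p)) :=
    (hG p hp).tendsto.comp (tendsto_nhdsWithin_iff.2 ⟨hup, Eventually.of_forall huU⟩)
  have hup' : Tendsto (fun n => u (n + 1)) l (𝓝 p) := by
    simpa using hd.add hup
  have hlim := ((hup.sub ((hGp.add (he.mono_left hl)).const_smul τ)).sub hup').inner (𝕜 := ℝ)
    ((tendsto_const_nhds (x := w)).sub hup')
  rw [add_zero] at hlim
  exact le_of_tendsto hlim (Eventually.of_forall fun n => hstep n w hw)

variable [CompleteSpace E]

theorem IsPerturbedStep.le_add (hU : Convex ℝ U) (hJ : IsLSmoothOn J G L U) (hτ : 0 < τ)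
    (huU : ∀ n, u n ∈ U) (hstep : IsPerturbedStep U G τ u e) (n : ℕ) :
    J (u (n + 1)) + (1 / τ - L / 2) * ‖u (n + 1) - u n‖ ^ 2
      ≤ J (u n) + ‖e n‖ * ‖u (n + 1) - u n‖ := by
  have h1 := hJ.le_add_inner hU (huU n) (huU (n + 1))
  have h2 := hstep n (u n) (huU n)
  set d := u (n + 1) - u n with hd
  have h3 : τ * (⟪G (u n), d⟫ + ⟪e n, d⟫) + ‖d‖ ^ 2 ≤ 0 := by
    have e1 : u n - τ • (G (u n) + e n) - u (n + 1) = -(d + τ • (G (u n) + e n)) := by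
      rw [hd]; abel
    have e2 : u n - u (n + 1) = -d := by rw [hd]; abel
    rw [e1, e2, inner_neg_neg, inner_add_left, real_inner_smul_left, inner_add_left,
      real_inner_self_eq_norm_sq] at h2
    linarith
  have h4 : ⟪G (u n), d⟫ + ⟪e n, d⟫ + 1 / τ * ‖d‖ ^ 2 ≤ 0 := by
    have : τ * (⟪G (u n), d⟫ + ⟪e n, d⟫ + 1 / τ * ‖d‖ ^ 2) ≤ 0 := by
      rw [mul_add, ← mul_assoc, mul_one_div_cancel hτ.ne', one_mul]
      exact h3
    exact nonpos_of_mul_nonpos_right this hτ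
  have h5 : -⟪e n, d⟫ ≤ ‖e n‖ * ‖d‖ := (neg_le_abs _).trans (abs_real_inner_le_norm _ _)
  linarith

/-- Near a value `v` that is not attained at a stationary point, the function values of late
iterates decrease: the steps that do not decrease `J` have length `O(‖e n‖)`, so that their
accumulation points are stationary. -/
theorem IsPerturbedStep.eventually_le (hUc : IsCompact U) (hU : Convex ℝ U)
    (hJ : IsLSmoothOn J G L U) (hτ : 0 < τ) (hc : 0 < 1 / τ - L / 2)
    (huU : ∀ n, u n ∈ U) (hstep : IsPerturbedStep U G τ u e) (he : Tendsto e atTop (𝓝 0))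
    {v : ℝ} (hv : v ∉ J '' stationarySet U G) :
    ∀ᶠ n in atTop ⊓ comap (fun n => J (u n)) (𝓝 v), J (u (n + 1)) ≤ J (u n) := by
  by_contra hcon
  set l := (atTop ⊓ comap (fun n => J (u n)) (𝓝 v)) ⊓ 𝓟 {n | J (u n) < J (u (n + 1))} with hl
  have hne : l.NeBot := by
    refine frequently_mem_iff_neBot.1 ?_
    exact fun h => hcon (h.mono fun n hn => not_lt.1 hn)
  let f : Ultrafilter ℕ := Ultrafilter.of l
  have hfl : (f : Filter ℕ) ≤ l := Ultrafilter.of_le l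
  have hf1 : (f : Filter ℕ) ≤ atTop := hfl.trans (inf_le_left.trans inf_le_left)
  have hf2 : Tendsto (fun n => J (u n)) f (𝓝 v) :=
    tendsto_comap.mono_left (hfl.trans (inf_le_left.trans inf_le_right))
  have hf3 : ∀ᶠ n in f, J (u n) < J (u (n + 1)) :=
    hfl (mem_inf_of_right (mem_principal_self _))
  have hd : Tendsto (fun n => u (n + 1) - u n) f (𝓝 0) := by
    refine squeeze_zero_norm' (a := fun n => ‖e n‖ / (1 / τ - L / 2)) ?_ ?_
    · filter_upwards [hf3] with n hn
      have h1 := hstep.le_add hU hJ hτ huU n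
      rw [le_div_iff₀ hc]
      by_contra! hlt
      nlinarith [norm_nonneg (u (n + 1) - u n)]
    · simpa using (he.norm.div_const (1 / τ - L / 2)).mono_left hf1
  obtain ⟨p, hp, hup⟩ := hUc.ultrafilter_le_nhds (f.map u)
    (le_principal_iff.2 (Eventually.of_forall (f := (f : Filter ℕ)) huU))
  have hup' : Tendsto u f (𝓝 p) := hup
  have hstat := hstep.mem_stationarySet hU hJ.continuousOn_gradient hτ huU he hf1 hd hp hup'
  have hJp : Tendsto (fun n => J (u n)) f (𝓝 (J p)) :=
    (hJ.hasGradientWithinAt p hp).continuousWithinAt.tendsto.comp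
      (tendsto_nhdsWithin_iff.2 ⟨hup', Eventually.of_forall huU⟩)
  exact hv ⟨p, hstat, tendsto_nhds_unique hJp hf2⟩

/-- Convergence of function values and stationarity of accumulation points for the projected
gradient method with errors that tend to zero, with no assumption on their rate. As upward jumps
of `J` become arbitrarily small, values outside the null set `J(S)` can eventually not be crossed
upwards. -/
theorem IsPerturbedStep.converges (hUc : IsCompact U) (hU : Convex ℝ U)
    (hJ : IsLSmoothOn J G L U) (hL : 0 < L) (hτ : 0 < τ) (hτL : τ < 2 / L)
    (huU : ∀ n, u n ∈ U) (hstep : IsPerturbedStep U G τ u e) (he : Tendsto e atTop (𝓝 0))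
    (hN : volume (J '' stationarySet U G) = 0) :
    (∀ p : E, MapClusterPt p atTop u → p ∈ stationarySet U G) ∧
      ∃ c : ℝ, Tendsto (fun n => J (u n)) atTop (𝓝 c) := by
  have hc : 0 < 1 / τ - L / 2 := by
    rw [sub_pos, lt_div_iff₀ hτ]
    rw [lt_div_iff₀ hL] at hτL
    linarith
  set c := 1 / τ - L / 2 with hcdef
  have hJc : ContinuousOn J U := fun p hp => (hJ.hasGradientWithinAt p hp).continuousWithinAt
  have hle : ∀ n, J (u (n + 1)) + c * ‖u (n + 1) - u n‖ ^ 2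
      ≤ J (u n) + ‖e n‖ * ‖u (n + 1) - u n‖ := hstep.le_add hU hJ hτ huU
  have hsmall : Tendsto (fun n => ‖e n‖ ^ 2 / (4 * c)) atTop (𝓝 0) := by
    simpa using (he.norm.pow 2).div_const (4 * c)
  -- Maximising `‖e n‖ d - c d ^ 2` over `d` bounds the upward jump of `J` in one step.
  have hjump : ∀ n, J (u (n + 1)) ≤ J (u n) + ‖e n‖ ^ 2 / (4 * c) := fun n => by
    have h1 := hle n
    have h2 : ‖e n‖ * ‖u (n + 1) - u n‖
        ≤ c * ‖u (n + 1) - u n‖ ^ 2 + ‖e n‖ ^ 2 / (4 * c) := by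
      have : 0 ≤ (2 * c * ‖u (n + 1) - u n‖ - ‖e n‖) ^ 2 / (4 * c) := by positivity
      have e1 : (2 * c * ‖u (n + 1) - u n‖ - ‖e n‖) ^ 2 / (4 * c)
          = c * ‖u (n + 1) - u n‖ ^ 2 - ‖e n‖ * ‖u (n + 1) - u n‖ + ‖e n‖ ^ 2 / (4 * c) := by
        field_simp
        ring
      linarith
    linarith
  have hdense : Dense (J '' stationarySet U G)ᶜ := by
    rw [← interior_eq_empty_iff_dense_compl]
    exact Measure.interior_eq_empty_of_null hN
  obtain ⟨B, hB⟩ := (hUc.image_of_continuousOn hJc).isBounded.exists_norm_le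
  have hB' : ∀ n, |J (u n)| ≤ B := fun n => hB _ ⟨u n, huU n, rfl⟩
  have hconv : ∃ a : ℝ, Tendsto (fun n => J (u n)) atTop (𝓝 a) := by
    refine tendsto_of_no_upcrossings hdense ?_
      (isBoundedUnder_of ⟨B, fun n => (abs_le.1 (hB' n)).2⟩)
      (isBoundedUnder_of ⟨-B, fun n => (abs_le.1 (hB' n)).1⟩)
    rintro a ha b - hab ⟨h1, h2⟩
    have h3 := hstep.eventually_le hUc hU hJ hτ hc huU he ha
    obtain ⟨s, hs, t, ht, hst⟩ := eventually_inf.1 h3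
    obtain ⟨V, hV, hVt⟩ := mem_comap.1 ht
    obtain ⟨δ, hδ, hδV⟩ := Metric.mem_nhds_iff.1 hV
    obtain ⟨N, hN⟩ := eventually_atTop.1
      ((show ∀ᶠ n in atTop, n ∈ s from hs).and (hsmall.eventually (gt_mem_nhds hδ)))
    -- Below `a - δ` a jump cannot reach beyond `a`, and between `a - δ` and `a` the values decrease.
    have htrap : ∀ n ≥ N, J (u n) ≤ a → J (u (n + 1)) ≤ a := fun n hn hna => by
      obtain ⟨hns, hnδ⟩ := hN n hn
      rcases le_or_gt (J (u n)) (a - δ) with h | h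
      · linarith [hjump n]
      · refine (hst n ⟨hns, hVt (hδV ?_)⟩).trans hna
        rw [Metric.mem_ball, Real.dist_eq, abs_lt]
        constructor <;> linarith
    obtain ⟨n₀, hn₀, hlt⟩ := frequently_atTop.1 h1 N
    have hall : ∀ n ≥ n₀, J (u n) ≤ a := fun n hn => by
      induction n, hn using Nat.le_induction with
      | base => exact hlt.le
      | succ n hn ih => exact htrap n (hn₀.trans hn) ih
    obtain ⟨n, hn, hbn⟩ := frequently_atTop.1 h2 n₀
    linarith [hall n hn]
  refine ⟨fun p hp => ?_, hconv⟩
  obtain ⟨a, ha⟩ := hconv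
  obtain ⟨D, hD⟩ := hUc.isBounded.exists_norm_le
  have hD' : ∀ n, ‖u (n + 1) - u n‖ ≤ 2 * D := fun n => by
    linarith [norm_sub_le (u (n + 1)) (u n), hD _ (huU n), hD _ (huU (n + 1))]
  -- Now that the values converge, the descent inequality forces the steps to tend to zero.
  have hsq : Tendsto (fun n => ‖u (n + 1) - u n‖ ^ 2) atTop (𝓝 0) := by
    have hlim : Tendsto (fun n => (J (u n) - J (u (n + 1)) + ‖e n‖ * (2 * D)) / c) atTop (𝓝 0) := by
      simpa using ((ha.sub (ha.comp (tendsto_add_atTop_nat 1))).add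
        (he.norm.mul_const (2 * D))).div_const c
    refine squeeze_zero (fun n => by positivity) (fun n => ?_) hlim
    rw [le_div_iff₀ hc]
    have := mul_le_mul_of_nonneg_left (hD' n) (norm_nonneg (e n))
    linarith [hle n]
  have hd : Tendsto (fun n => u (n + 1) - u n) atTop (𝓝 0) := by
    rw [tendsto_zero_iff_norm_tendsto_zero]
    simpa using hsq.sqrt
  obtain ⟨f, hf, hfp⟩ := mapClusterPt_iff_ultrafilter.1 hp
  have hpU : p ∈ U := hUc.isClosed.mem_of_tendsto hfp (Eventually.of_forall huU)
  exact hstep.mem_stationarySet hU hJ.continuousOn_gradient hτ huU he hf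
    (hd.mono_left hf) hpU hfp

end Optimisation

/-! ### Differentiation under the integral sign -/

section ContinuousOn

variable {E F : Type*} [NormedAddCommGroup E] [NormedAddCommGroup F] {U : Set E} {K : Set F}

/-- A function that is continuous on a compact set of full measure is integrable. -/
theorem integrable_of_continuousOn [MeasurableSpace F] [BorelSpace F] {μ : Measure F}
    [IsProbabilityMeasure μ] {E' : Type*} [NormedAddCommGroup E'] {f : F → E'}
    (hK : IsCompact K) (hμK : ∀ᵐ x ∂μ, x ∈ K) (hf : ContinuousOn f K) : Integrable f μ := by
  rw [← Measure.restrict_eq_self_of_ae_mem hμK]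
  exact hf.integrableOn_compact hK

theorem continuousOn_section {g : E → F → E} (hg : ContinuousOn (Function.uncurry g) (U ×ˢ K))
    {u : E} (hu : u ∈ U) : ContinuousOn (g u) K :=
  hg.comp (f := fun x => (u, x)) (by fun_prop) fun _ hx => ⟨hu, hx⟩

theorem IsC1On.continuousOn_left [NormedSpace ℝ E] [NormedSpace ℝ F] {j : E → F → ℝ}
    {j' : E → F → (E × F →L[ℝ] ℝ)} {X : Set F} (hj : IsC1On j j' U X) {u : E} (hu : u ∈ U) :
    ContinuousOn (j u) X := fun x hx =>
  (hj.hasFDerivWithinAt u hu x hx).continuousWithinAt.comp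
    (f := fun x => (u, x)) (by fun_prop) fun _ hx' => ⟨hu, hx'⟩

end ContinuousOn

section Gradient

variable {E F : Type*} [NormedAddCommGroup E] [InnerProductSpace ℝ E] [CompleteSpace E]
  [NormedAddCommGroup F] [NormedSpace ℝ F]
  {U : Set E} {X K : Set F} {j : E → F → ℝ} {j' : E → F → (E × F →L[ℝ] ℝ)}

theorem IsC1On.continuousOn_grad₁ (hj : IsC1On j j' U X) :
    ContinuousOn (Function.uncurry (grad₁ j')) (U ×ˢ X) := by
  refine (InnerProductSpace.toDual ℝ E).symm.continuous.comp_continuousOn ?_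
  exact hj.continuousOn.clm_comp continuousOn_const

theorem IsC1On.hasGradientWithinAt (hj : IsC1On j j' U X) {u : E} (hu : u ∈ U) {x : F}
    (hx : x ∈ X) : HasGradientWithinAt (fun v => j v x) (grad₁ j' u x) U u := by
  rw [hasGradientWithinAt_iff_hasFDerivWithinAt, grad₁, LinearIsometryEquiv.apply_symm_apply]
  have h : HasFDerivWithinAt (fun v : E => (v, x)) (ContinuousLinearMap.inl ℝ E F) U u :=
    (hasFDerivAt_prodMk_left u x).hasFDerivWithinAt
  have hmaps : Set.MapsTo (fun v : E => (v, x)) U (U ×ˢ X) := fun v hv => ⟨hv, hx⟩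
  exact (hj.hasFDerivWithinAt u hu x hx).comp u h hmaps

variable [MeasurableSpace F] [BorelSpace F] {μ : Measure F} [IsProbabilityMeasure μ]

/-- In directions between points of `U`, every gradient of `J` relative to `U` acts like the
expected partial gradient. The two vectors may differ if `U` has empty interior. -/
theorem inner_integral_grad₁_eq (hUc : IsCompact U) (hU : Convex ℝ U) (hK : IsCompact K)
    (hKX : K ⊆ X) (hμK : ∀ᵐ x ∂μ, x ∈ K) (hj : IsC1On j j' U X) {G : E → E}
    (hG : ∀ u ∈ U, HasGradientWithinAt (objective μ j) (G u) U u) {u v w : E} (hu : u ∈ U)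
    (hv : v ∈ U) (hw : w ∈ U) :
    ⟪∫ x, grad₁ j' u x ∂μ, v - w⟫ = ⟪G u, v - w⟫ := by
  have hgK := hj.continuousOn_grad₁.mono (Set.prod_mono_right (s := U) hKX)
  suffices H : ∀ v ∈ U, ⟪∫ x, grad₁ j' u x ∂μ, v - u⟫ = ⟪G u, v - u⟫ by
    have h1 := H v hv
    have h2 := H w hw
    rw [inner_sub_right] at h1 h2 ⊢
    rw [inner_sub_right] at h1 h2 ⊢
    linarith
  intro v hv
  set d := v - u with hd
  -- Both sides are the one-sided derivative at `0` of `t ↦ J (u + t • d)`; the difference quotients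
  -- of `j` are dominated by a bound of the partial gradient on `U ×ˢ K`.
  obtain ⟨C, hC⟩ := (hUc.prod hK).exists_bound_of_continuousOn hgK
  have h1 := hasDerivWithinAt_iff_tendsto_slope.1
    (hasDerivWithinAt_segment hU hG hu hv (Set.left_mem_Icc.2 zero_le_one))
  set l := 𝓝[Set.Icc (0 : ℝ) 1 \ {0}] 0 with hl
  have hlne : l.NeBot := by
    rw [hl, Set.Icc_sdiff_left, nhdsWithin_Ioc_eq_nhdsGT one_pos]
    infer_instance
  have hint : ∀ t ∈ Set.Icc (0 : ℝ) 1, Integrable (j (u + t • d)) μ := fun t ht =>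
    integrable_of_continuousOn hK hμK
      ((hj.continuousOn_left (mapsTo_segment hU hu hv ht)).mono hKX)
  have hu0 : u + (0 : ℝ) • d = u := by simp
  have h2 : Tendsto (fun t => ∫ x, slope (fun t : ℝ => j (u + t • d) x) 0 t ∂μ) l
      (𝓝 (∫ x, ⟪grad₁ j' u x, d⟫ ∂μ)) := by
    refine tendsto_integral_filter_of_dominated_convergence (fun _ => C * ‖d‖) ?_ ?_
      (integrable_const _) ?_
    · filter_upwards [self_mem_nhdsWithin] with t ht
      have : Integrable (fun x => slope (fun t : ℝ => j (u + t • d) x) 0 t) μ := by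
        simp only [slope_def_module]
        exact ((hint t ht.1).sub (hint 0 (Set.left_mem_Icc.2 zero_le_one))).smul
          ((t - 0)⁻¹)
      exact this.aestronglyMeasurable
    · filter_upwards [self_mem_nhdsWithin] with t ht
      filter_upwards [hμK] with x hx
      have hbd := hU.norm_image_sub_le_of_norm_hasFDerivWithin_le (f := fun v => j v x) (C := C)
        (fun z hz => (hj.hasGradientWithinAt hz (hKX hx)).hasFDerivWithinAt)
        (fun z hz => by simpa using hC (z, x) ⟨hz, hx⟩) hu (mapsTo_segment hU hu hv ht.1)
      have ht0 : 0 < t := lt_of_le_of_ne ht.1.1 (Ne.symm ht.2)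
      rw [slope_def_module, norm_smul, sub_zero, norm_inv, Real.norm_of_nonneg ht0.le, hu0,
        inv_mul_le_iff₀ ht0]
      refine hbd.trans (le_of_eq ?_)
      rw [add_sub_cancel_left, norm_smul, Real.norm_of_nonneg ht0.le]
      ring
    · filter_upwards [hμK] with x hx
      have h3 := hasDerivWithinAt_iff_tendsto_slope.1
        (hasDerivWithinAt_segment hU (fun z hz => hj.hasGradientWithinAt hz (hKX hx)) hu hv
          (Set.left_mem_Icc.2 zero_le_one))
      simpa only [← hd, hu0] using h3
  have h4 : ∀ᶠ t in l, slope (fun t : ℝ => objective μ j (u + t • d)) 0 t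
      = ∫ x, slope (fun t : ℝ => j (u + t • d) x) 0 t ∂μ := by
    filter_upwards [self_mem_nhdsWithin] with t ht
    simp only [slope_def_module, objective]
    rw [integral_smul, integral_sub (hint t ht.1) (hint 0 (Set.left_mem_Icc.2 zero_le_one))]
  have h5 := tendsto_nhds_unique (h2.congr' (h4.mono fun t ht => ht.symm)) h1
  rw [← hd, hu0] at h5
  rw [← h5, real_inner_comm, ← integral_inner
    (integrable_of_continuousOn hK hμK (continuousOn_section hgK hu))]
  simp only [real_inner_comm]

end Gradient

/-! ### Nearest neighbours in a dense history -/

section Covering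

variable {E F : Type*} [NormedAddCommGroup E] [NormedAddCommGroup F] {U : Set E} {K : Set F}
  {u : ℕ → E} {x : ℕ → F} {n : ℕ} {ε : ℝ}

theorem exists_close (hUc : IsCompact U) (hK : IsCompact K)
    {g : E → F → E} (hg : ContinuousOn (Function.uncurry g) (U ×ˢ K)) {ε : ℝ} (hε : 0 < ε) :
    ∃ δ > 0, ∀ u ∈ U, ∀ v ∈ U, ∀ s ∈ K, ∀ t ∈ K, ‖u - v‖ + ‖s - t‖ ≤ δ →
      ‖g v t - g u s‖ ≤ ε := by
  obtain ⟨δ, hδ, h⟩ := Metric.uniformContinuousOn_iff.1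
    ((hUc.prod hK).uniformContinuousOn_of_continuous hg) ε hε
  refine ⟨δ / 2, half_pos hδ, fun u hu v hv s hs t ht hle => ?_⟩
  have := h (v, t) ⟨hv, ht⟩ (u, s) ⟨hu, hs⟩ ?_
  · rw [dist_eq_norm] at this
    exact this.le
  · rw [Prod.dist_eq, max_lt_iff, dist_comm v, dist_comm t, dist_eq_norm, dist_eq_norm]
    constructor <;> linarith [norm_nonneg (u - v), norm_nonneg (s - t)]

theorem norm_sum_sub_le {a b : ℕ → E} {ε : ℝ} (N : ℕ) (h : ∀ l, ‖a l - b l‖ ≤ ε) :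
    ‖∑ l ∈ Finset.range N, a l - ∑ l ∈ Finset.range N, b l‖ ≤ ε * N := by
  rw [← Finset.sum_sub_distrib]
  refine (norm_sum_le_of_le _ fun l _ => h l).trans ?_
  simp [mul_comm]

/-- The history of the method is `ε`-dense: every `(u n, s)` with `s ∈ K` has a point of the
history within distance `ε`. -/
def IsCovered (K : Set F) (u : ℕ → E) (x : ℕ → F) (n : ℕ) (ε : ℝ) : Prop :=
  ∀ s ∈ K, ∃ k ≤ n, ‖u n - u k‖ + ‖s - x k‖ ≤ ε

theorem IsCovered.sampleCell_le [MeasurableSpace F] {Q : NearestRule F normDist} 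
    (h : IsCovered K u x n ε) {s : F} (hs : s ∈ K) : ‖s - x (sampleCell Q x n s)‖ ≤ ε := by
  obtain ⟨k, hk, hle⟩ := h s hs
  refine (Q.nearest n (fun i => x i) s ⟨k, Nat.lt_succ_of_le hk⟩).trans ?_
  exact (le_add_of_nonneg_left (norm_nonneg _)).trans hle

variable [MeasurableSpace F] [MeasurableSpace E] {R : NearestRule (E × F) sumDist}

theorem IsCovered.cell_le (h : IsCovered K u x n ε) {s : F} (hs : s ∈ K) :
    ‖u n - u (cell R u x n s)‖ + ‖s - x (cell R u x n s)‖ ≤ ε := by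
  obtain ⟨k, hk, hle⟩ := h s hs
  exact (R.nearest n (fun i => (u i, x i)) (u n, s) ⟨k, Nat.lt_succ_of_le hk⟩).trans hle

/-- The points used by the hybrid methods are still close: two nearest neighbour steps. -/
theorem IsCovered.cell_sampleCell_le {Q : NearestRule F normDist}
    (h : IsCovered K u x n ε) (hx : ∀ n, x n ∈ K) {s : F} (hs : s ∈ K) :
    ‖u n - u (cell R u x n (x (sampleCell Q x n s)))‖
      + ‖s - x (cell R u x n (x (sampleCell Q x n s)))‖ ≤ ε + ε := by
  have h1 := h.cell_le (R := R) (hx (sampleCell Q x n s))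
  have h2 := h.sampleCell_le (Q := Q) hs
  have h3 := norm_sub_le_norm_sub_add_norm_sub s (x (sampleCell Q x n s))
    (x (cell R u x n (x (sampleCell Q x n s))))
  linarith

theorem measurable_cell (R : NearestRule (E × F) sumDist) (u : ℕ → E) (x : ℕ → F) (n : ℕ) :
    Measurable (cell R u x n) :=
  (R.measurable_idx n).comp (measurable_const.prodMk (measurable_const.prodMk measurable_id))

theorem measurable_sampleCell (Q : NearestRule F normDist) (x : ℕ → F) (n : ℕ) :
    Measurable (sampleCell Q x n) :=
  (Q.measurable_idx n).comp (measurable_const.prodMk measurable_id)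

end Covering

/-! ### The search direction as an average over nearest neighbours -/

section Direction

variable {E F : Type*} [NormedAddCommGroup E] [NormedSpace ℝ E]

theorem sum_card_fiber_smul {ι : Type*} [Fintype ι] [DecidableEq ι] (s : Finset ℕ) (κ : ℕ → ι)
    (a : ι → E) :
    ∑ k, (((s.filter fun l => κ l = k).card : ℝ)) • a k = ∑ l ∈ s, a (κ l) := by
  simp only [Finset.card_filter, Nat.cast_sum, Finset.sum_smul]
  rw [Finset.sum_comm]
  simp [ite_smul]

theorem sum_sum_ite_smul {ι : Type*} [Fintype ι] [DecidableEq ι] (κ : ι → ι) (b : ι → ℝ)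
    (a : ι → E) :
    ∑ k, (∑ i, if κ i = k then b i else 0) • a k = ∑ i, b i • a (κ i) := by
  simp only [Finset.sum_smul]
  rw [Finset.sum_comm]
  simp [ite_smul]

theorem norm_sum_measureReal_smul_sub_integral_le [MeasurableSpace F] {μ : Measure F}
    [IsProbabilityMeasure μ] {K : Set F} {ε : ℝ} {ι : Type*} [Fintype ι] [MeasurableSpace ι]
    [MeasurableSingletonClass ι] [CompleteSpace E] (hμK : ∀ᵐ s ∂μ, s ∈ K) {κ : F → ι}
    (hκ : Measurable κ) (a : ι → E) {f : F → E} (hf : Integrable f μ) (h : ∀ s ∈ K, ‖a (κ s) - f s‖ ≤ ε) :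
    ‖∑ k, μ.real {s | κ s = k} • a k - ∫ s, f s ∂μ‖ ≤ ε := by
  have : IsProbabilityMeasure (μ.map κ) := Measure.isProbabilityMeasure_map hκ.aemeasurable
  have ha : Integrable a (μ.map κ) := Integrable.of_finite
  have h1 : ∑ k, μ.real {s | κ s = k} • a k = ∫ s, a (κ s) ∂μ := by
    rw [← integral_map hκ.aemeasurable ha.aestronglyMeasurable, integral_fintype ha]
    refine Finset.sum_congr rfl fun k _ => ?_
    rw [map_measureReal_apply hκ (measurableSet_singleton k)]
    rfl
  have haκ : Integrable (fun s => a (κ s)) μ := ha.comp_measurable hκ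
  rw [h1, ← integral_sub haκ hf]
  simpa using norm_integral_le_of_norm_le_const (μ := μ) (hμK.mono h)

variable [NormedAddCommGroup F] [MeasurableSpace F] [MeasurableSpace E]
  (μ : Measure F) (g : E → F → E) (R : NearestRule (E × F) sumDist) (Q : NearestRule F normDist)
  (u : ℕ → E) (x y : ℕ → F) (n : ℕ)

/-- In the hybrid methods a query point is sent to its nearest sample `x i`, and `x i` in turn to
the index of the cell `M_k` that contains it. -/
theorem direction_exactHybrid :
    direction μ g R Q .exactHybrid u x y n = ∑ i : Fin (n + 1),
      μ.real {s | sampleCell Q x n s = i} •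
        g (u (cell R u x n (x i))) (x (cell R u x n (x i))) :=
  sum_sum_ite_smul (fun i : Fin (n + 1) => cell R u x n (x i))
    (fun i => μ.real {s | sampleCell Q x n s = i}) fun k => g (u k) (x k)

theorem direction_inexactHybrid (m : ℕ → ℕ) :
    direction μ g R Q (.inexactHybrid m) u x y n = ((n : ℝ) + 1 + m n)⁻¹ •
      (∑ l ∈ Finset.range (n + 1), g (u (cell R u x n (x (sampleCell Q x n (x l)))))
          (x (cell R u x n (x (sampleCell Q x n (x l)))))
        + ∑ l ∈ Finset.range (m n), g (u (cell R u x n (x (sampleCell Q x n (y l)))))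
          (x (cell R u x n (x (sampleCell Q x n (y l)))))) := by
  refine (sum_sum_ite_smul (fun i : Fin (n + 1) => cell R u x n (x i))
    (fun i => ((((Finset.range (n + 1)).filter fun l => sampleCell Q x n (x l) = i).card : ℝ)
          + (((Finset.range (m n)).filter fun l => sampleCell Q x n (y l) = i).card : ℝ))
          / ((n : ℝ) + 1 + (m n : ℝ))) fun k => g (u k) (x k)).trans ?_
  simp only [div_eq_inv_mul, mul_smul, ← Finset.smul_sum, add_smul, Finset.sum_add_distrib]
  rw [sum_card_fiber_smul _ _ fun i : Fin (n + 1) =>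
      g (u (cell R u x n (x i))) (x (cell R u x n (x i))),
    sum_card_fiber_smul _ _ fun i : Fin (n + 1) =>
      g (u (cell R u x n (x i))) (x (cell R u x n (x i)))]

theorem direction_empirical :
    direction μ g R Q .empirical u x y n = ((n : ℝ) + 1)⁻¹ •
      ∑ l ∈ Finset.range (n + 1), g (u (cell R u x n (x l))) (x (cell R u x n (x l))) := by
  rw [← sum_card_fiber_smul _ _ fun k : Fin (n + 1) => g (u k) (x k), Finset.smul_sum]
  simp only [direction, weight, div_eq_inv_mul, mul_smul]

end Direction

/-! ### Consistency of the search direction -/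

section Consistency

variable {E F : Type*} [NormedAddCommGroup E] [NormedSpace ℝ E] [NormedAddCommGroup F]
  {U : Set E} {K : Set F} {g : E → F → E}

/-- The averages of `g v` over the samples `x` converge to `H v`, uniformly for `v ∈ U`. -/
def UniformLLN (U : Set E) (g : E → F → E) (H : E → E) (x : ℕ → F) : Prop :=
  ∀ ε > 0, ∀ᶠ n : ℕ in atTop, ∀ v ∈ U, ‖∑ l ∈ Finset.range n, (g v (x l) - H v)‖ ≤ ε * n

/-- Once the history is dense and averages obey a uniform law of large numbers, the search
direction of each of the four methods approximates the expected gradient at the iterate. -/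
theorem tendsto_direction_sub [CompleteSpace E] [MeasurableSpace E] [MeasurableSpace F]
    [BorelSpace F] {μ : Measure F} [IsProbabilityMeasure μ]
    (hUc : IsCompact U) (hK : IsCompact K) (hμK : ∀ᵐ x ∂μ, x ∈ K)
    (hg : ContinuousOn (Function.uncurry g) (U ×ˢ K))
    (R : NearestRule (E × F) sumDist) (Q : NearestRule F normDist) (w : WeightMethod)
    {u : ℕ → E} {x y : ℕ → F} (hu : ∀ n, u n ∈ U) (hx : ∀ n, x n ∈ K) (hy : ∀ n, y n ∈ K)
    (hcov : ∀ ε > 0, ∀ᶠ n in atTop, IsCovered K u x n ε)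
    (hLx : UniformLLN U g (fun v => ∫ s, g v s ∂μ) x)
    (hLy : UniformLLN U g (fun v => ∫ s, g v s ∂μ) y) :
    Tendsto (fun n => direction μ g R Q w u x y n - ∫ s, g (u n) s ∂μ) atTop (𝓝 0) := by
  set H : E → E := fun v => ∫ s, g v s ∂μ with hH
  have hint : ∀ v ∈ U, Integrable (g v) μ := fun v hv => integrable_of_continuousOn hK hμK
    (continuousOn_section hg hv)
  suffices hmain : ∀ ε > 0, ∀ᶠ n in atTop, ‖direction μ g R Q w u x y n - H (u n)‖ ≤ 3 * ε by
    rw [tendsto_zero_iff_norm_tendsto_zero, Metric.tendsto_nhds]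
    intro ε hε
    filter_upwards [hmain (ε / 6) (by positivity)] with n hn
    rw [Real.dist_eq, sub_zero, abs_norm]
    linarith
  intro ε hε
  obtain ⟨δ, hδ, hclose⟩ := exists_close hUc hK hg hε
  have hcov1 : ∀ᶠ n in atTop, ∀ s ∈ K,
      ‖g (u (cell R u x n s)) (x (cell R u x n s)) - g (u n) s‖ ≤ ε := by
    filter_upwards [hcov δ hδ] with n hn s hs
    exact hclose _ (hu _) _ (hu _) _ hs _ (hx _) (hn.cell_le hs)
  have hcov2 : ∀ᶠ n in atTop, ∀ s ∈ K,
      ‖g (u (cell R u x n (x (sampleCell Q x n s))))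
        (x (cell R u x n (x (sampleCell Q x n s)))) - g (u n) s‖ ≤ ε := by
    filter_upwards [hcov (δ / 2) (half_pos hδ)] with n hn s hs
    refine hclose _ (hu _) _ (hu _) _ hs _ (hx _) ?_
    linarith [hn.cell_sampleCell_le (R := R) (Q := Q) hx hs]
  have hLx' : ∀ᶠ n : ℕ in atTop,
      ‖∑ l ∈ Finset.range (n + 1), (g (u n) (x l) - H (u n))‖ ≤ ε * ((n : ℝ) + 1) := by
    filter_upwards [(tendsto_add_atTop_nat 1).eventually (hLx ε hε)] with n hn
    simpa using hn (u n) (hu n)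
  cases w with
  | exact =>
    filter_upwards [hcov1] with n hn
    refine (norm_sum_measureReal_smul_sub_integral_le hμK (measurable_cell R u x n)
      (fun k => g (u k) (x k)) (hint _ (hu n)) hn).trans ?_
    linarith
  | exactHybrid =>
    filter_upwards [hcov2] with n hn
    rw [direction_exactHybrid]
    refine (norm_sum_measureReal_smul_sub_integral_le hμK (measurable_sampleCell Q x n)
      (fun i => g (u (cell R u x n (x i))) (x (cell R u x n (x i)))) (hint _ (hu n)) hn).trans ?_
    linarith
  | empirical =>
    filter_upwards [hcov1, hLx'] with n hn hL
    rw [direction_empirical]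
    have hN : (0 : ℝ) < (n : ℝ) + 1 := by positivity
    have h1 := norm_sum_sub_le (n + 1) fun l => hn (x l) (hx l)
    have e : ((n : ℝ) + 1)⁻¹ • ∑ l ∈ Finset.range (n + 1),
          g (u (cell R u x n (x l))) (x (cell R u x n (x l))) - H (u n)
        = ((n : ℝ) + 1)⁻¹ • ((∑ l ∈ Finset.range (n + 1),
          g (u (cell R u x n (x l))) (x (cell R u x n (x l)))
            - ∑ l ∈ Finset.range (n + 1), g (u n) (x l))
          + ∑ l ∈ Finset.range (n + 1), (g (u n) (x l) - H (u n))) := by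
      rw [Finset.sum_sub_distrib, sub_add_sub_cancel, smul_sub, Finset.sum_const,
        Finset.card_range, ← Nat.cast_smul_eq_nsmul ℝ, Nat.cast_add_one, inv_smul_smul₀ hN.ne']
    rw [e, norm_smul, norm_inv, Real.norm_of_nonneg hN.le, inv_mul_le_iff₀ hN]
    refine (norm_add_le _ _).trans ?_
    push_cast at h1
    nlinarith
  | inexactHybrid m =>
    obtain ⟨C, hC⟩ := (hUc.prod hK).exists_bound_of_continuousOn hg
    have hHC : ∀ v ∈ U, ‖H v‖ ≤ C := fun v hv => by
      simpa using norm_integral_le_of_norm_le_const (μ := μ)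
        (hμK.mono fun s hs => hC (v, s) ⟨hv, hs⟩)
    have hC0 : 0 ≤ C := (norm_nonneg _).trans (hHC _ (hu 0))
    obtain ⟨M, hM⟩ := eventually_atTop.1 (hLy ε hε)
    -- Few auxiliary samples are outnumbered by the `n + 1` samples `x`; many of them obey the
    -- law of large numbers themselves.
    have hLy' : ∀ᶠ n : ℕ in atTop, ‖∑ l ∈ Finset.range (m n), (g (u n) (y l) - H (u n))‖
        ≤ ε * ((n : ℝ) + 1 + m n) := by
      have hlarge : ∀ᶠ n : ℕ in atTop, M * (2 * C) / ε ≤ n :=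
        tendsto_natCast_atTop_atTop.eventually_ge_atTop _
      filter_upwards [hlarge] with n hn
      rcases le_total M (m n) with h | h
      · refine (hM _ h _ (hu n)).trans (mul_le_mul_of_nonneg_left ?_ hε.le)
        linarith [(Nat.cast_nonneg n : (0 : ℝ) ≤ n)]
      · have h1 : ‖∑ l ∈ Finset.range (m n), (g (u n) (y l) - H (u n))‖ ≤ m n * (2 * C) := by
          refine (norm_sum_le_of_le (f := fun l => g (u n) (y l) - H (u n)) _
            fun l _ => (norm_sub_le _ _).trans
              (add_le_add (hC (u n, y l) ⟨hu n, hy l⟩) (hHC _ (hu n)))).trans ?_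
          simp [two_mul, mul_add]
        have h2 : (m n : ℝ) * (2 * C) ≤ M * (2 * C) := by gcongr
        rw [div_le_iff₀ hε] at hn
        have h3 : 0 ≤ ε * (1 + m n) := by positivity
        nlinarith
    filter_upwards [hcov2, hLx', hLy'] with n hn hL hL'
    rw [direction_inexactHybrid]
    set N : ℝ := (n : ℝ) + 1 + m n with hNdef
    have hN : (0 : ℝ) < N := by positivity
    have h1 := norm_sum_sub_le (n + 1) fun l => hn (x l) (hx l)
    have h2 := norm_sum_sub_le (m n) fun l => hn (y l) (hy l)
    push_cast at h1
    set A := ∑ l ∈ Finset.range (n + 1), g (u (cell R u x n (x (sampleCell Q x n (x l)))))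
          (x (cell R u x n (x (sampleCell Q x n (x l))))) with hA
    set B := ∑ l ∈ Finset.range (m n), g (u (cell R u x n (x (sampleCell Q x n (y l)))))
          (x (cell R u x n (x (sampleCell Q x n (y l))))) with hB
    have e : N⁻¹ • (A + B) - H (u n) = N⁻¹ •
        (((A - ∑ l ∈ Finset.range (n + 1), g (u n) (x l))
          + (B - ∑ l ∈ Finset.range (m n), g (u n) (y l)))
        + (∑ l ∈ Finset.range (n + 1), (g (u n) (x l) - H (u n))
          + ∑ l ∈ Finset.range (m n), (g (u n) (y l) - H (u n)))) := by
      have e1 : H (u n) = N⁻¹ • ((n + 1 + m n : ℕ) • H (u n)) := by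
        rw [← Nat.cast_smul_eq_nsmul ℝ, Nat.cast_add, Nat.cast_add_one, inv_smul_smul₀ hN.ne']
      conv_lhs => rw [e1]
      rw [← smul_sub]
      congr 1
      simp only [Finset.sum_sub_distrib, Finset.sum_const, Finset.card_range, add_smul]
      abel
    rw [e, norm_smul, norm_inv, Real.norm_of_nonneg hN.le, inv_mul_le_iff₀ hN]
    have h3 := norm_add₄_le (a := A - ∑ l ∈ Finset.range (n + 1), g (u n) (x l))
      (b := B - ∑ l ∈ Finset.range (m n), g (u n) (y l))
      (c := ∑ l ∈ Finset.range (n + 1), (g (u n) (x l) - H (u n)))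
      (d := ∑ l ∈ Finset.range (m n), (g (u n) (y l) - H (u n)))
    rw [← add_assoc]
    refine h3.trans ?_
    have hmn : (0 : ℝ) ≤ ε * m n := by positivity
    nlinarith

end Consistency

/-! ### The uniform law of large numbers -/

section LLN

variable {E F Ω : Type*} [NormedAddCommGroup E] [NormedSpace ℝ E] [CompleteSpace E]
  [NormedAddCommGroup F] [MeasurableSpace F] [BorelSpace F] [MeasurableSpace Ω]
  {P : Measure Ω} {μ : Measure F} [IsProbabilityMeasure μ]
  {U : Set E} {K : Set F} {g : E → F → E} {x : ℕ → Ω → F}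

/-- The uniform law of large numbers over the compact set `U` is the strong law in the Banach
space of continuous functions on `U`. -/
theorem ae_uniformLLN (hUc : IsCompact U) (hK : IsCompact K) (hμK : ∀ᵐ s ∂μ, s ∈ K)
    (hg : ContinuousOn (Function.uncurry g) (U ×ˢ K)) (hxm : ∀ n, Measurable (x n))
    (hxμ : ∀ n, P.map (x n) = μ) (hind : Pairwise fun i k => IndepFun (x i) (x k) P) :
    ∀ᵐ ω ∂P, UniformLLN U g (fun v => ∫ s, g v s ∂μ) (fun n => x n ω) := by
  classical
  have : CompactSpace U := isCompact_iff_compactSpace.1 hUc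
  borelize C(U, E)
  let Ψ : C(K × U, E) := ⟨fun p => g p.2 p.1, hg.comp_continuous
    (f := fun p : K × U => ((p.2 : E), (p.1 : F))) (by fun_prop) fun p => ⟨p.2.2, p.1.2⟩⟩
  let Φ : F → C(U, E) := fun s => if h : s ∈ K then Ψ.curry ⟨s, h⟩ else 0
  have hΦ : ∀ s ∈ K, ∀ v : U, Φ s v = g v s := fun s hs v => by
    simp only [Φ, hs, dite_true]
    rfl
  have hΦc : ContinuousOn Φ K := by
    rw [continuousOn_iff_continuous_domRestrict]
    convert Ψ.curry.continuous using 1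
    ext s v
    simp [Φ]
  have hΦm : Measurable Φ := by
    have h := hΦc.measurable_piecewise (g := fun _ => 0) continuousOn_const hK.measurableSet
    convert h using 1
    ext s v
    by_cases hs : s ∈ K <;> simp [Φ, hs]
  have hΦi : Integrable Φ μ := integrable_of_continuousOn hK hμK hΦc
  have hΦx : Integrable (fun ω => Φ (x 0 ω)) P := by
    rw [← hxμ 0] at hΦi
    exact hΦi.comp_measurable (hxm 0)
  have hmean : ∀ v : U, (∫ ω, Φ (x 0 ω) ∂P) v = ∫ s, g v s ∂μ := fun v => by
    rw [← integral_map (hxm 0).aemeasurable (by rw [hxμ 0]; exact hΦi.aestronglyMeasurable), hxμ 0]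
    have h1 := (ContinuousMap.evalCLM ℝ v).integral_comp_comm hΦi
    simp only [ContinuousMap.evalCLM_apply] at h1
    rw [← h1]
    exact integral_congr_ae (hμK.mono fun s hs => hΦ s hs v)
  have hxK : ∀ᵐ ω ∂P, ∀ n, x n ω ∈ K := ae_all_iff.2 fun n => by
    rw [← hxμ n] at hμK
    exact ae_of_ae_map (hxm n).aemeasurable hμK
  have hlaw := strong_law_ae (μ := P) (fun n ω => Φ (x n ω)) hΦx
    (fun i k hik => (hind hik).comp hΦm hΦm) fun i =>
      (IdentDistrib.mk (hxm i).aemeasurable (hxm 0).aemeasurable ((hxμ i).trans (hxμ 0).symm)).comp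
        hΦm
  filter_upwards [hlaw, hxK] with ω hω hωK ε hε
  filter_upwards [(Metric.tendsto_nhds.1 hω) ε hε, eventually_gt_atTop 0] with n hn hn0 v hv
  have hn' : (0 : ℝ) < n := Nat.cast_pos.2 hn0
  rw [dist_eq_norm] at hn
  have h2 := (ContinuousMap.norm_coe_le_norm _ (⟨v, hv⟩ : U)).trans hn.le
  rw [ContinuousMap.sub_apply, hmean, ContinuousMap.smul_apply, ContinuousMap.sum_apply] at h2
  simp only [fun n => hΦ _ (hωK n)] at h2
  have e : ∑ l ∈ Finset.range n, (g v (x l ω) - ∫ s, g v s ∂μ)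
      = (n : ℝ) • ((n : ℝ)⁻¹ • ∑ l ∈ Finset.range n, g v (x l ω) - ∫ s, g v s ∂μ) := by
    rw [smul_sub, smul_inv_smul₀ hn'.ne', Finset.sum_sub_distrib, Finset.sum_const,
      Finset.card_range, Nat.cast_smul_eq_nsmul]
  rw [e, norm_smul, Real.norm_of_nonneg hn'.le, mul_comm]
  exact mul_le_mul_of_nonneg_right h2 hn'.le

end LLN

/-! ### Density of the history -/

section Coverage

variable {E F Ω : Type*} [mΩ : MeasurableSpace Ω] {P : Measure Ω} [IsProbabilityMeasure P]
  {ℱ : Filtration ℕ mΩ} {v : ℕ → Ω → E} {x : ℕ → Ω → F}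

/-- If the samples `x n` are independent of the past and `v n` is determined by the past, then
every visit of `v n` to `A` is a fresh chance for `x n` to hit `B`: by the conditional
Borel–Cantelli lemma, infinitely many visits lead to infinitely many hits. -/
theorem ae_frequently_and [MeasurableSpace E] [MeasurableSpace F] {μ : Measure F}
    (hv : ∀ n, Measurable[ℱ n] (v n)) (hx : ∀ n, Measurable[ℱ (n + 1)] (x n))
    (hind : ∀ n, Indep (MeasurableSpace.comap (x n) inferInstance) (ℱ n) P)
    (hxμ : ∀ n, P.map (x n) = μ) {A : Set E} {B : Set F} (hA : MeasurableSet A)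
    (hB : MeasurableSet B) (hμB : 0 < μ B) :
    ∀ᵐ ω ∂P, (∃ᶠ n in atTop, v n ω ∈ A) → ∃ᶠ n in atTop, v n ω ∈ A ∧ x n ω ∈ B := by
  have hxm : ∀ n, Measurable (x n) := fun n => (hx n).mono (ℱ.le _) le_rfl
  have : IsProbabilityMeasure μ := hxμ 0 ▸ Measure.isProbabilityMeasure_map (hxm 0).aemeasurable
  -- The index is shifted by one because the outcome of `x k` is known only at time `k + 1`.
  let s : ℕ → Set Ω := fun n => Nat.casesOn n ∅ fun k => v k ⁻¹' A ∩ x k ⁻¹' B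
  have hs : ∀ n, MeasurableSet[ℱ n] (s n) := by
    rintro (_ | k)
    · exact @MeasurableSet.empty _ (ℱ 0)
    · exact MeasurableSet.inter (ℱ.mono (Nat.le_succ k) _ (hv k hA)) (hx k hB)
  have hr : 0 < μ.real B := ENNReal.toReal_pos hμB.ne' (measure_ne_top _ _)
  have hcond : ∀ k, P[(s (k + 1)).indicator (1 : Ω → ℝ) | ℱ k]
      =ᵐ[P] (v k ⁻¹' A).indicator fun _ => μ.real B := fun k => by
    have h1 : (s (k + 1)).indicator (1 : Ω → ℝ)
        = (v k ⁻¹' A).indicator ((x k ⁻¹' B).indicator 1) := by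
      rw [Set.indicator_indicator]
    have hBint : Integrable ((x k ⁻¹' B).indicator (1 : Ω → ℝ)) P :=
      (integrable_const (1 : ℝ)).indicator (hxm k hB)
    have h2 : P[(x k ⁻¹' B).indicator (1 : Ω → ℝ) | ℱ k] =ᵐ[P] fun _ => μ.real B := by
      have hBm : MeasurableSet[MeasurableSpace.comap (x k) inferInstance] (x k ⁻¹' B) :=
        ⟨B, hB, rfl⟩
      have h3 := condExp_indep_eq (hxm k).comap_le (ℱ.le k)
        (f := (x k ⁻¹' B).indicator (1 : Ω → ℝ))
        (StronglyMeasurable.indicator (@stronglyMeasurable_one _ _ (_) _ _) hBm) (hind k)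
      rw [integral_indicator_one (hxm k hB)] at h3
      rwa [← hxμ k, map_measureReal_apply (hxm k) hB]
    rw [h1]
    refine (condExp_indicator hBint (hv k hA)).trans ?_
    filter_upwards [h2] with ω hω
    simp only [Set.indicator, hω]
  filter_upwards [ae_mem_limsup_atTop_iff P hs, ae_all_iff.2 hcond] with ω hω hωc hfreq
  have h4 : ω ∈ limsup (fun n => v n ⁻¹' A) atTop := mem_limsup_iff_frequently_mem.2 hfreq
  rw [Set.limsup_eq_tendsto_sum_indicator_atTop hr] at h4
  simp only [hωc] at hω
  have h5 := mem_limsup_iff_frequently_mem.1 (hω.2 h4)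
  rw [frequently_atTop] at h5 ⊢
  intro a
  obtain ⟨n, hn, hns⟩ := h5 (a + 1)
  obtain ⟨k, rfl⟩ := Nat.exists_eq_add_of_le' (Nat.one_le_of_lt hn)
  exact ⟨k, by omega, hns⟩

/-- Almost surely the history becomes dense: cover `U` and `K` by finitely many small balls; the
balls in `U` visited infinitely often have, jointly with every ball around a point of `K`, been
hit, and the others are eventually left. -/
theorem ae_eventually_isCovered [NormedAddCommGroup E] [MeasurableSpace E] [BorelSpace E]
    [NormedAddCommGroup F] [MeasurableSpace F] [BorelSpace F] {μ : Measure F} {U : Set E}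
    {K : Set F} (hUc : IsCompact U) (hK : IsCompact K) (hKμ : K ⊆ μ.support)
    (hv : ∀ n, Measurable[ℱ n] (v n)) (hx : ∀ n, Measurable[ℱ (n + 1)] (x n))
    (hind : ∀ n, Indep (MeasurableSpace.comap (x n) inferInstance) (ℱ n) P)
    (hxμ : ∀ n, P.map (x n) = μ) (hvU : ∀ n ω, v n ω ∈ U) :
    ∀ᵐ ω ∂P, ∀ ε > 0, ∀ᶠ n in atTop, IsCovered K (fun n => v n ω) (fun n => x n ω) n ε := by
  have hm : ∀ m : ℕ, ∀ᵐ ω ∂P, ∀ᶠ n in atTop,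
      IsCovered K (fun n => v n ω) (fun n => x n ω) n (4 * (1 / ((m : ℝ) + 1))) := by
    intro m
    set r : ℝ := 1 / ((m : ℝ) + 1) with hr
    have hr0 : 0 < r := by positivity
    obtain ⟨S, -, hSf, hS⟩ := hUc.finite_cover_balls hr0
    obtain ⟨T, hTK, hTf, hT⟩ := hK.finite_cover_balls hr0
    have hall : ∀ᵐ ω ∂P, ∀ c ∈ S, ∀ b ∈ T, (∃ᶠ n in atTop, v n ω ∈ Metric.ball c r) →
        ∃ᶠ n in atTop, v n ω ∈ Metric.ball c r ∧ x n ω ∈ Metric.ball b r := by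
      refine (ae_ball_iff hSf.countable).2 fun c _ => (ae_ball_iff hTf.countable).2 fun b hb => ?_
      exact ae_frequently_and hv hx hind hxμ Metric.isOpen_ball.measurableSet
        Metric.isOpen_ball.measurableSet
        ((Measure.mem_support_iff_forall b).1 (hKμ (hTK hb)) _ (Metric.ball_mem_nhds b hr0))
    filter_upwards [hall] with ω hω
    have hev : ∀ᶠ n in atTop, ∀ c ∈ S, ∀ b ∈ T, v n ω ∈ Metric.ball c r →
        ∃ k ≤ n, v k ω ∈ Metric.ball c r ∧ x k ω ∈ Metric.ball b r := by
      refine (eventually_all_finite hSf).2 fun c hc => (eventually_all_finite hTf).2 fun b hb => ?_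
      by_cases hf : ∃ᶠ n in atTop, v n ω ∈ Metric.ball c r
      · obtain ⟨k, hk⟩ := (hω c hc b hb hf).exists
        filter_upwards [eventually_ge_atTop k] with n hn _
        exact ⟨k, hn, hk⟩
      · filter_upwards [not_frequently.1 hf] with n hn h
        exact absurd h hn
    filter_upwards [hev] with n hn s hs
    obtain ⟨c, hc, hvc⟩ := Set.mem_iUnion₂.1 (hS (hvU n ω))
    obtain ⟨b, hb, hsb⟩ := Set.mem_iUnion₂.1 (hT hs)
    obtain ⟨k, hk, hkc, hkb⟩ := hn c hc b hb hvc
    refine ⟨k, hk, ?_⟩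
    rw [← dist_eq_norm, ← dist_eq_norm]
    rw [Metric.mem_ball] at hvc hsb hkc hkb
    linarith [dist_triangle_right (v n ω) (v k ω) c, dist_triangle_right s (x k ω) b]
  filter_upwards [ae_all_iff.2 hm] with ω hω ε hε
  obtain ⟨m, hm⟩ := exists_nat_one_div_lt (show 0 < ε / 4 by positivity)
  filter_upwards [hω m] with n hn s hs
  obtain ⟨k, hk, hle⟩ := hn s hs
  exact ⟨k, hk, hle.trans (by linarith)⟩

end Coverage

/-! ### Measurability of the iterates -/

section Measurability

variable {E F Ω : Type*} [NormedAddCommGroup E] [NormedAddCommGroup F]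
  [MeasurableSpace E] [MeasurableSpace F]

theorem cell_congr (R : NearestRule (E × F) sumDist) {u u' : ℕ → E} (x : ℕ → F) {n : ℕ}
    (h : ∀ k ≤ n, u k = u' k) : cell R u x n = cell R u' x n := by
  funext s
  have h1 : (fun i : Fin (n + 1) => (u i, x i)) = fun i : Fin (n + 1) => (u' i, x i) :=
    funext fun i => by rw [h i (Nat.le_of_lt_succ i.2)]
  simp only [cell, h1, h n le_rfl]

theorem direction_congr [NormedSpace ℝ E] (μ : Measure F) {g g' : E → F → E}
    (R : NearestRule (E × F) sumDist)
    (Q : NearestRule F normDist) (w : WeightMethod) {u u' : ℕ → E} {x : ℕ → F} (y : ℕ → F) {n : ℕ}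
    (h : ∀ k ≤ n, u k = u' k) (hg : ∀ k ≤ n, g (u k) (x k) = g' (u' k) (x k)) :
    direction μ g R Q w u x y n = direction μ g' R Q w u' x y n := by
  refine Finset.sum_congr rfl fun k _ => ?_
  rw [hg k (Nat.le_of_lt_succ k.2)]
  congr 1
  cases w <;> simp only [weight, cell_congr R x h]

variable [MeasurableSpace Ω] {u : ℕ → Ω → E} {x y : ℕ → Ω → F} {n : ℕ}

theorem measurable_cell_comp (R : NearestRule (E × F) sumDist)
    (hu : ∀ k ≤ n, Measurable (u k)) (hx : ∀ k ≤ n, Measurable (x k)) {s : Ω → F}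
    (hs : Measurable s) :
    Measurable fun ω => cell R (fun k => u k ω) (fun k => x k ω) n (s ω) := by
  refine (R.measurable_idx n).comp (Measurable.prodMk (measurable_pi_lambda _ fun i => ?_)
    ((hu n le_rfl).prodMk hs))
  exact (hu i (Nat.le_of_lt_succ i.2)).prodMk (hx i (Nat.le_of_lt_succ i.2))

theorem measurable_sampleCell_comp (Q : NearestRule F normDist)
    (hx : ∀ k ≤ n, Measurable (x k)) {s : Ω → F} (hs : Measurable s) :
    Measurable fun ω => sampleCell Q (fun k => x k ω) n (s ω) := by
  refine (Q.measurable_idx n).comp (Measurable.prodMk (measurable_pi_lambda _ fun i => ?_) hs)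
  exact hx i (Nat.le_of_lt_succ i.2)

theorem measurable_measureReal_fiber {F ι : Type*} [MeasurableSpace F]
    [MeasurableSpace ι] [MeasurableSingletonClass ι] {μ : Measure F} [IsProbabilityMeasure μ]
    {κ : Ω → F → ι}
    (hκ : Measurable fun p : Ω × F => κ p.1 p.2) (k : ι) :
    Measurable fun ω => μ.real {s | κ ω s = k} :=
  (measurable_measure_prodMk_left (ν := μ) (hκ (measurableSet_singleton k))).ennreal_toReal

theorem measurable_card_filter {ι : Type*} [DecidableEq ι] [MeasurableSpace ι]
    [MeasurableSingletonClass ι] {s : Finset ℕ} {κ : ℕ → Ω → ι} (hκ : ∀ l ∈ s, Measurable (κ l))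
    (k : ι) : Measurable fun ω => ((s.filter fun l => κ l ω = k).card : ℝ) := by
  simp only [Finset.card_filter, Nat.cast_sum, Nat.cast_ite, Nat.cast_one, Nat.cast_zero]
  exact Finset.measurable_sum _ fun l hl =>
    Measurable.ite (hκ l hl (measurableSet_singleton k)) measurable_const measurable_const

theorem measurable_weight {μ : Measure F} [IsProbabilityMeasure μ]
    (R : NearestRule (E × F) sumDist) (Q : NearestRule F normDist) (w : WeightMethod)
    (hu : ∀ k ≤ n, Measurable (u k)) (hx : ∀ k ≤ n, Measurable (x k)) (hy : ∀ k, Measurable (y k))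
    (k : Fin (n + 1)) :
    Measurable fun ω => weight μ R Q w (fun k => u k ω) (fun k => x k ω) (fun k => y k ω) n k := by
  have hcell : ∀ i : Fin (n + 1), MeasurableSet
      {ω | cell R (fun k => u k ω) (fun k => x k ω) n (x i ω) = k} := fun i =>
    measurable_cell_comp R hu hx (hx i (Nat.le_of_lt_succ i.2)) (measurableSet_singleton k)
  cases w with
  | exact =>
    exact measurable_measureReal_fiber (measurable_cell_comp R
      (u := fun k (p : Ω × F) => u k p.1) (x := fun k (p : Ω × F) => x k p.1)
      (fun k hk => (hu k hk).comp measurable_fst) (fun k hk => (hx k hk).comp measurable_fst)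
      measurable_snd) k
  | exactHybrid =>
    refine Finset.measurable_sum _ fun i _ => Measurable.ite (hcell i) ?_ measurable_const
    exact measurable_measureReal_fiber (measurable_sampleCell_comp Q
      (x := fun k (p : Ω × F) => x k p.1) (fun k hk => (hx k hk).comp measurable_fst)
      measurable_snd) i
  | inexactHybrid m =>
    refine Finset.measurable_sum _ fun i _ => Measurable.ite (hcell i) ?_ measurable_const
    refine Measurable.div_const (Measurable.add ?_ ?_) _
    · exact measurable_card_filter (fun l hl => measurable_sampleCell_comp Q hx
        (hx l (Nat.le_of_lt_succ (Finset.mem_range.1 hl)))) i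
    · exact measurable_card_filter (fun l _ => measurable_sampleCell_comp Q hx (hy l)) i
  | empirical =>
    refine Measurable.div_const ?_ _
    exact measurable_card_filter (fun l hl => measurable_cell_comp R hu hx
        (hx l (Nat.le_of_lt_succ (Finset.mem_range.1 hl)))) k

theorem measurable_direction [NormedSpace ℝ E] [BorelSpace E] [SecondCountableTopology E]
    {μ : Measure F} [IsProbabilityMeasure μ]
    {g : E → F → E} (hg : Measurable (Function.uncurry g))
    (R : NearestRule (E × F) sumDist) (Q : NearestRule F normDist) (w : WeightMethod)
    (hu : ∀ k ≤ n, Measurable (u k)) (hx : ∀ k ≤ n, Measurable (x k))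
    (hy : ∀ k, Measurable (y k)) :
    Measurable fun ω =>
      direction μ g R Q w (fun k => u k ω) (fun k => x k ω) (fun k => y k ω) n :=
  Finset.measurable_sum _ fun k _ => (measurable_weight R Q w hu hx hy k).smul
    (hg.comp ((hu k (Nat.le_of_lt_succ k.2)).prodMk (hx k (Nat.le_of_lt_succ k.2))))

end Measurability

/-! ### The filtration of the samples and the stopped iterates -/

section Filtration

variable {F Ω : Type*} [MeasurableSpace F] [mΩ : MeasurableSpace Ω] {x y : ℕ → Ω → F}

/-- Indices, in the combined family of samples `Sum.elim x y`, of what is known before the sample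
`x n` is drawn: the earlier samples `x i` and all auxiliary samples. -/
def pastIndices (n : ℕ) : Set (ℕ ⊕ ℕ) := {i | ∀ k, i = Sum.inl k → k < n}

/-- The σ-algebras generated by `x 0, …, x (n - 1)` and all auxiliary samples `y`. The iterate
`u n` uses only some of the `y`, but including them all keeps `x n` independent of the past. -/
def pastFiltration (hx : ∀ n, Measurable (x n)) (hy : ∀ n, Measurable (y n)) :
    Filtration ℕ mΩ where
  seq n := ⨆ i ∈ pastIndices n, MeasurableSpace.comap (Sum.elim x y i) inferInstance
  mono' _ _ hnm := biSup_mono fun _ hi k hk => (hi k hk).trans_le hnm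
  le' _ := iSup₂_le fun i _ => by
    cases i with
    | inl k => exact (hx k).comap_le
    | inr k => exact (hy k).comap_le

variable (hx : ∀ n, Measurable (x n)) (hy : ∀ n, Measurable (y n))

theorem measurable_pastFiltration_left {k n : ℕ} (h : k < n) :
    Measurable[pastFiltration hx hy n] (x k) := by
  refine Measurable.of_comap_le ?_
  refine le_iSup₂_of_le (f := fun i (_ : i ∈ pastIndices n) =>
    MeasurableSpace.comap (Sum.elim x y i) inferInstance) (Sum.inl k) ?_ le_rfl
  intro l hl
  rwa [← Sum.inl_injective hl]

theorem measurable_pastFiltration_right (k n : ℕ) :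
    Measurable[pastFiltration hx hy n] (y k) := by
  refine Measurable.of_comap_le ?_
  refine le_iSup₂_of_le (f := fun i (_ : i ∈ pastIndices n) =>
    MeasurableSpace.comap (Sum.elim x y i) inferInstance) (Sum.inr k) ?_ le_rfl
  intro l hl
  cases hl

theorem indep_pastFiltration {P : Measure Ω} (hind : iIndepFun (Sum.elim x y) P) (n : ℕ) :
    Indep (MeasurableSpace.comap (x n) inferInstance) (pastFiltration hx hy n) P := by
  have hle : ∀ i, MeasurableSpace.comap (Sum.elim x y i) inferInstance ≤ mΩ := by
    rintro (k | k)
    exacts [(hx k).comap_le, (hy k).comap_le]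
  have hdisj : Disjoint {Sum.inl n} (pastIndices n) :=
    Set.disjoint_singleton_left.2 fun h => lt_irrefl n (h n rfl)
  have h := indep_iSup_of_disjoint hle hind.iIndep hdisj
  rwa [iSup_singleton] at h

end Filtration

section Stopped

open Classical in
/-- The iterates `u n`, replaced by the starting point once a sample has left `X`. This null event
is harmless, but the gradient need not be measurable outside `U × X`. -/
noncomputable def stopped {E F Ω : Type*} (X : Set F) (u₀ : E) (x : ℕ → Ω → F)
    (u : ℕ → Ω → E) (n : ℕ) (ω : Ω) : E :=
  if ∀ i < n, x i ω ∈ X then u n ω else u₀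

theorem stopped_of_forall {E F Ω : Type*} {X : Set F} {x : ℕ → Ω → F} {u : ℕ → Ω → E}
    {u₀ : E} {n : ℕ} {ω : Ω} (h : ∀ i < n, x i ω ∈ X) :
    stopped X u₀ x u n ω = u n ω := if_pos h

variable {E F Ω : Type*} [NormedAddCommGroup E] [InnerProductSpace ℝ E] [MeasurableSpace E]
  [BorelSpace E] [SecondCountableTopology E] [NormedAddCommGroup F] [MeasurableSpace F]
  [BorelSpace F] [mΩ : MeasurableSpace Ω] {x y : ℕ → Ω → F} {u : ℕ → Ω → E}
  {U : Set E} {X : Set F}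

theorem measurable_stopped (hUc : IsCompact U) (hU : Convex ℝ U) (hX : IsOpen X)
    {g : E → F → E} (hg : ContinuousOn (Function.uncurry g) (U ×ˢ X))
    {μ : Measure F} [IsProbabilityMeasure μ] (R : NearestRule (E × F) sumDist)
    (Q : NearestRule F normDist) (w : WeightMethod) {τ : ℝ} {u₀ : E}
    (huU : ∀ n ω, u n ω ∈ U)
    (hu : ∀ ω, IsCSG U μ g R Q w τ u₀ (fun n => x n ω) (fun n => y n ω) (fun n => u n ω))
    (hx : ∀ n, Measurable (x n)) (hy : ∀ n, Measurable (y n)) (n : ℕ) :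
    Measurable[pastFiltration hx hy n] (stopped X u₀ x u n) := by
  classical
  have hUX : MeasurableSet (U ×ˢ X) := hUc.isClosed.measurableSet.prod hX.measurableSet
  let g' : E → F → E := fun v s => (U ×ˢ X).piecewise (Function.uncurry g) 0 (v, s)
  have hg' : Measurable (Function.uncurry g') :=
    hg.measurable_piecewise continuousOn_const hUX
  by_cases hne : U.Nonempty
  swap
  · have : IsEmpty Ω := ⟨fun ω => hne ⟨_, huU 0 ω⟩⟩
    intro s _
    rw [Set.eq_empty_of_isEmpty (stopped X u₀ x u n ⁻¹' s)]
    exact @MeasurableSet.empty _ (pastFiltration hx hy n)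
  obtain ⟨π, hπc, hπ⟩ := exists_continuous_isProj hUc hU hne
  induction n using Nat.strong_induction_on with
  | _ n ih =>
    cases n with
    | zero =>
      have h0 : stopped X u₀ x u 0 = fun _ => u₀ := by
        funext ω
        rw [stopped_of_forall fun i hi => absurd hi (Nat.not_lt_zero i), (hu ω).start]
      rw [h0]
      exact measurable_const
    | succ n =>
      let ℱ := pastFiltration hx hy
      have hstep : stopped X u₀ x u (n + 1) = fun ω => if ∀ i < n + 1, x i ω ∈ X then
          π (stopped X u₀ x u n ω - τ • direction μ g' R Q w (fun k => stopped X u₀ x u k ω)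
            (fun k => x k ω) (fun k => y k ω) n) else u₀ := by
        funext ω
        by_cases hω : ∀ i < n + 1, x i ω ∈ X
        · have heq : ∀ k ≤ n, u k ω = stopped X u₀ x u k ω := fun k hk =>
            (stopped_of_forall fun i hi => hω i (by omega)).symm
          rw [if_pos hω, stopped_of_forall hω, ← heq n le_rfl,
            ← direction_congr (u := fun k => u k ω) μ (g := g) R Q w (fun k => y k ω) heq]
          · exact ((hu ω).step n).unique hU (hπ _)
          · intro k hk
            rw [← heq k hk]
            have hmem : (u k ω, x k ω) ∈ U ×ˢ X := ⟨huU k ω, hω k (Nat.lt_succ_of_le hk)⟩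
            exact (Set.piecewise_eq_of_mem _ (Function.uncurry g) 0 hmem).symm
        · rw [if_neg hω]
          exact if_neg hω
      rw [hstep]
      have hset : MeasurableSet[ℱ (n + 1)] {ω | ∀ i < n + 1, x i ω ∈ X} := by
        have : {ω | ∀ i < n + 1, x i ω ∈ X} = ⋂ i ∈ Finset.range (n + 1), x i ⁻¹' X := by
          ext ω; simp
        rw [this]
        exact Finset.measurableSet_biInter _ fun i hi =>
          measurable_pastFiltration_left hx hy (Finset.mem_range.1 hi) hX.measurableSet
      have hprev : ∀ k ≤ n, Measurable[ℱ (n + 1)] (stopped X u₀ x u k) := fun k hk =>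
        (ih k (Nat.lt_succ_of_le hk)).mono (ℱ.mono (by omega)) le_rfl
      have hdir := @measurable_direction E F Ω _ _ _ _ (ℱ (n + 1)) (stopped X u₀ x u) x y n _ _ _
        μ _ g' hg' R Q w hprev
        (fun k hk => measurable_pastFiltration_left hx hy (Nat.lt_succ_of_le hk))
        (fun k => measurable_pastFiltration_right hx hy k _)
      exact Measurable.ite hset (hπc.measurable.comp ((hprev n le_rfl).sub (hdir.const_smul τ)))
        measurable_const

end Stopped

end CSG

theorem mainTheorem2
    {E : Type*} [NormedAddCommGroup E] [InnerProductSpace ℝ E] [FiniteDimensional ℝ E]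
    [CompleteSpace E] [MeasurableSpace E] [BorelSpace E]
    {F : Type*} [NormedAddCommGroup F] [NormedSpace ℝ F] [FiniteDimensional ℝ F]
    [MeasurableSpace F] [BorelSpace F]
    {Ω : Type*} [MeasurableSpace Ω] (P : Measure Ω) [IsProbabilityMeasure P]
    (U : Set E) (hUc : IsCompact U) (hUconv : Convex ℝ U)
    (X : Set F) (hXo : IsOpen X) (hXb : Bornology.IsBounded X)
    (μ : Measure F) [IsProbabilityMeasure μ] (hμX : μ.support ⊆ X)
    (j : E → F → ℝ) (j' : E → F → (E × F →L[ℝ] ℝ)) (hj : CSG.IsC1On j j' U X)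
    (G : E → E) (L : ℝ) (hL : 0 < L) (hJ : CSG.IsLSmoothOn (CSG.objective μ j) G L U)
    (x y : ℕ → Ω → F)
    (hxm : ∀ n, Measurable (x n)) (hym : ∀ n, Measurable (y n))
    (hxμ : ∀ n, P.map (x n) = μ) (hyμ : ∀ n, P.map (y n) = μ)
    (hindep : iIndepFun (Sum.elim x y) P)
    (R : CSG.NearestRule (E × F) CSG.sumDist) (Q : CSG.NearestRule F CSG.normDist)
    (w : CSG.WeightMethod)
    (τ : ℝ) (hτ : 0 < τ) (hτL : τ < 2 / L)
    (u₀ : E) (hu₀ : u₀ ∈ U)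
    (u : ℕ → Ω → E)
    (hu : ∀ ω, CSG.IsCSG U μ (CSG.grad₁ j') R Q w τ u₀
      (fun n => x n ω) (fun n => y n ω) (fun n => u n ω))
    (hN : volume (CSG.objective μ j '' CSG.stationarySet U G) = 0) :
    ∀ᵐ ω ∂P,
      (∀ p : E, MapClusterPt p atTop (fun n => u n ω) → p ∈ CSG.stationarySet U G) ∧
      ∃ c : ℝ, Tendsto (fun n => CSG.objective μ j (u n ω)) atTop (𝓝 c) := by
  have : ProperSpace E := FiniteDimensional.proper_real E
  have : ProperSpace F := FiniteDimensional.proper_real F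
  have hK : IsCompact μ.support :=
    Metric.isCompact_of_isClosed_isBounded Measure.isClosed_support (hXb.subset hμX)
  have hμK : ∀ᵐ s ∂μ, s ∈ μ.support := Measure.support_mem_ae
  have huU : ∀ n ω, u n ω ∈ U := fun n ω => by
    cases n with
    | zero => rw [(hu ω).start]; exact hu₀
    | succ n => exact ((hu ω).step n).1
  have hg := hj.continuousOn_grad₁
  have hgK := hg.mono (Set.prod_mono_right (s := U) hμX)
  have hxK : ∀ᵐ ω ∂P, ∀ n, x n ω ∈ μ.support := ae_all_iff.2 fun n =>
    ae_of_ae_map (hxm n).aemeasurable (by rwa [hxμ n])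
  have hyK : ∀ᵐ ω ∂P, ∀ n, y n ω ∈ μ.support := ae_all_iff.2 fun n =>
    ae_of_ae_map (hym n).aemeasurable (by rwa [hyμ n])
  have hLx := CSG.ae_uniformLLN hUc hK hμK hgK hxm hxμ fun i k hik =>
    hindep.indepFun (Sum.inl_injective.ne hik)
  have hLy := CSG.ae_uniformLLN hUc hK hμK hgK hym hyμ fun i k hik =>
    hindep.indepFun (Sum.inr_injective.ne hik)
  have hcov := CSG.ae_eventually_isCovered hUc hK subset_rfl
    (CSG.measurable_stopped hUc hUconv hXo hg R Q w huU hu hxm hym)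
    (fun n => CSG.measurable_pastFiltration_left hxm hym (Nat.lt_succ_self n))
    (CSG.indep_pastFiltration hxm hym hindep) hxμ fun n ω => by
      unfold CSG.stopped
      split_ifs
      exacts [huU n ω, hu₀]
  filter_upwards [hxK, hyK, hLx, hLy, hcov] with ω hxω hyω hLxω hLyω hcovω
  simp only [fun n => CSG.stopped_of_forall (X := X) (u₀ := u₀) (x := x) (u := u) (n := n) (ω := ω)
    fun i _ => hμX (hxω i)] at hcovω
  have he := CSG.tendsto_direction_sub hUc hK hμK hgK R Q w (fun n => huU n ω) hxω hyω hcovω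
    hLxω hLyω
  refine CSG.IsPerturbedStep.converges hUc hUconv hJ hL hτ hτL (fun n => huU n ω) ?_ he hN
  -- The error is `direction n - ∫ g (u n) dμ`, and `v - u (n + 1)` is a difference of points of `U`.
  intro n v hv
  have h1 := ((CSG.isProj_iff_inner_le_zero hUconv).1 ((hu ω).step n)).2 v hv
  have h2 := CSG.inner_integral_grad₁_eq hUc hUconv hK hμX hμK hj hJ.hasGradientWithinAt
    (huU n ω) hv (huU (n + 1) ω)
  simp only [inner_sub_left, inner_add_left, real_inner_smul_left] at h1 ⊢
  rw [← h2]
  linarith
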